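/- Consider Heston parameters $\tilde\kappa,\tilde\theta,\tilde\sigma>0$ and $\tilde\rho=\rho\in(-1,1)$, i.e. $dS=\sqrt{v}\,S\,dW$, $dv=\tilde\kappa(\tilde\theta-v)\,dt+\tilde\sigma\sqrt v\,dZ$, $d\langle W,Z\rangle=\rho\,dt$. For a maturity $T>0$ set $$\theta=\frac{4\tilde\kappa\tilde\theta T}{\tilde\sigma^2(1-\rho^2)}\Bigl(\sqrt{(2\tilde\kappa-\rho\tilde\sigma)^2+\tilde\sigma^2(1-\rho^2)}-(2\tilde\kappa-\rho\tilde\sigma)\Bigr),\qquad \varphi=\frac{\tilde\sigma}{\tilde\kappa\tilde\theta T}.$$ The Long Term Heston SVI approximation (Gatheral–Jacquier) is the total implied variance $$w_T(k)=a+b\bigl(\rho(k-m)+\sqrt{(k-m)^2+\sigma^2}\bigr),\qquad a=\tfrac{\theta}{2}(1-\rho^2),\quad b=\tfrac{\theta\varphi}{2},\quad m=-\tfrac{\rho}{\varphi},\quad \sigma=\tfrac{\sqrt{1-\rho^2}}{\varphi}.$$ A total implied variance $w>0$ is free of Butterfly arbitrage if the normalized Black–Scholes Call price curve $C(x)=C_{BS}\bigl(x,\sqrt{w(\log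 x)}\bigr)$ (unit underlying, $C(0)=1$) is convex in the strike $x\ge 0$ and satisfies $(1-x)^+\le C(x)\le 1$ for all $x\ge0$. Finally, for $r\in[0,1)$ let $$N(l)=\sqrt{1-r^2}+rl+\sqrt{l^2+1},\qquad g_2(l,r)=N''(l)-\frac{N'(l)^2}{2N(l)} .$$ **(i)** For every $T>0$, $w_T$ is an SSVI slice: $\theta,\varphi>0$ and $$w_T(k)=\frac\theta2\Bigl(1+\rho\varphi k+\sqrt{(\varphi k+\rho)^2+1-\rho^2}\Bigr)\quad\text{for all }k\in\mathbb R,$$ and its slope parameter does not depend on $T$: $$b=\frac{2}{\tilde\sigma(1-\rho^2)}\Bigl(\sqrt{(2\tilde\kappa-\rho\tilde\sigma)^2+\tilde\sigma^2(1-\rho^2)}-(2\tilde\kappa-\rho\tilde\sigma)\Bigr).$$ **(ii)** The function $g_2(\cdot,|\rho|)$ attains its minimum over $\mathbb R$ at a point $m_2(|\rho|)>0$, which is its only positive point of (even local) minimum. If moreover $\tilde\kappa>\rho\tilde\sigma$ (equivalently $b(1+|\rho|)<2$), then $w_T$ is free of Butterfly arbitrage as soon as $$T\ \ge\ -\frac{8\,b\,\tilde\sigma\,g_2\bigl(m_2(|\rho|),|\rho|\bigr)}{\tilde\kappa\,\tilde\theta\,\sqrt{1-\rho^2}\,\bigl(4-b^2(1+|\rho|)^2\bigr)}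 .$$ -/

import Mathlib

noncomputable section

/-- The five parameters of a (raw) SVI smile. -/
structure SVIParams where
  a : ℝ
  b : ℝ
  ρ : ℝ
  m : ℝ
  σ : ℝ

/-- SVI total implied variance as a function of the log-forward moneyness `k`. -/
def SVIParams.totalVariance (p : SVIParams) (k : ℝ) : ℝ :=
  p.a + p.b * (p.ρ * (k - p.m) + Real.sqrt ((k - p.m) ^ 2 + p.σ ^ 2))

/-- The SSVI slice with parameters `θ, φ, ρ`. -/
def ssvi (θ φ ρ k : ℝ) : ℝ :=
  θ / 2 * (1 + ρ * φ * k + Real.sqrt ((φ * k + ρ) ^ 2 + 1 - ρ ^ 2))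

/-- Standard normal cumulative distribution function. -/
def stdNormalCDF (x : ℝ) : ℝ :=
  ProbabilityTheory.cdf (ProbabilityTheory.gaussianReal 0 1) x

/-- Normalized (unit underlying, zero rates) Black–Scholes Call price with strike `κ ≥ 0` and
total implied volatility `u > 0`, i.e. `u ^ 2` is the total implied variance.
At strike zero the price is that of the underlying. -/
def bsCall (κ u : ℝ) : ℝ :=
  if κ = 0 then 1
  else stdNormalCDF (-Real.log κ / u + u / 2) - κ * stdNormalCDF (-Real.log κ / u - u / 2)

/-- The Call price curve, as a function of the strike, of the smile with total implied
variance `w` (a function of the log-forward moneyness). -/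
def callCurve (w : ℝ → ℝ) (κ : ℝ) : ℝ :=
  bsCall κ (Real.sqrt (w (Real.log κ)))

/-- The smile `w` is free of Butterfly arbitrage: it is a genuine (positive) total variance, and
its Call price curve is convex in the strike `κ ≥ 0` and satisfies `(1 - κ)⁺ ≤ C κ ≤ 1`. -/
def ButterflyArbitrageFree (w : ℝ → ℝ) : Prop :=
  (∀ k, 0 < w k) ∧
  ConvexOn ℝ (Set.Ici 0) (callCurve w) ∧
  ∀ κ, 0 ≤ κ → max (1 - κ) 0 ≤ callCurve w κ ∧ callCurve w κ ≤ 1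

/-- Normalized SVI smile. -/
def sviN (γ ρ l : ℝ) : ℝ := γ + ρ * l + Real.sqrt (l ^ 2 + 1)

/-- First derivative of `sviN` in `l`. -/
def sviN' (ρ l : ℝ) : ℝ := ρ + l / Real.sqrt (l ^ 2 + 1)

/-- Second derivative of `sviN` in `l`; the denominator is `(l ^ 2 + 1) ^ (3 / 2)`. -/
def sviN'' (l : ℝ) : ℝ := 1 / Real.sqrt (l ^ 2 + 1) ^ 3

/-- The function `g₂ = N'' - N' ^ 2 / (2 N)` of an SVI. -/
def sviG2 (γ ρ l : ℝ) : ℝ := sviN'' l - sviN' ρ l ^ 2 / (2 * sviN γ ρ l)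

/-- The function `g₂(l, ρ)` of an SSVI, for which `γ = √(1 - ρ ^ 2)`. -/
def ssviG2 (l ρ : ℝ) : ℝ := sviG2 (Real.sqrt (1 - ρ ^ 2)) ρ l

/-- `m` is the only positive point of minimum of `f`: it is positive, `f` attains its minimum at
`m`, and no other positive point is a point of minimum of `f`, not even of local minimum. -/
def IsOnlyPositiveMin (f : ℝ → ℝ) (m : ℝ) : Prop :=
  0 < m ∧ (∀ l, f m ≤ f l) ∧ ∀ l, 0 < l → IsLocalMin f l → l = m

/-- Parameters of the Heston model
`dS = √v S dW`, `dv = κ (θ - v) dt + σ √v dZ`, `d⟨W, Z⟩ = ρ dt`. -/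
structure HestonParams where
  κ : ℝ
  θ : ℝ
  σ : ℝ
  ρ : ℝ
  κ_pos : 0 < κ
  θ_pos : 0 < θ
  σ_pos : 0 < σ
  abs_ρ_lt_one : |ρ| < 1

namespace HestonParams

/-- The SSVI parameter `θ` of the Long Term Heston approximation at maturity `T`. -/
def ssviθ (H : HestonParams) (T : ℝ) : ℝ :=
  4 * H.κ * H.θ * T / (H.σ ^ 2 * (1 - H.ρ ^ 2)) *
    (Real.sqrt ((2 * H.κ - H.ρ * H.σ) ^ 2 + H.σ ^ 2 * (1 - H.ρ ^ 2)) - (2 * H.κ - H.ρ * H.σ))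

/-- The SSVI parameter `φ` of the Long Term Heston approximation at maturity `T`. -/
def ssviφ (H : HestonParams) (T : ℝ) : ℝ := H.σ / (H.κ * H.θ * T)

/-- The Long Term Heston SVI approximation at maturity `T`. -/
def longTermSVI (H : HestonParams) (T : ℝ) : SVIParams where
  a := H.ssviθ T / 2 * (1 - H.ρ ^ 2)
  b := H.ssviθ T * H.ssviφ T / 2
  ρ := H.ρ
  m := -H.ρ / H.ssviφ T
  σ := Real.sqrt (1 - H.ρ ^ 2) / H.ssviφ T

/-- The slope parameter `b` in terms of the Heston parameters. -/
def slope (H : HestonParams) : ℝ :=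
  2 / (H.σ * (1 - H.ρ ^ 2)) *
    (Real.sqrt ((2 * H.κ - H.ρ * H.σ) ^ 2 + H.σ ^ 2 * (1 - H.ρ ^ 2)) - (2 * H.κ - H.ρ * H.σ))

/-- The lower bound on the maturity `T`, where `m` stands for the minimum point of
`g₂(·, |ρ|)`. -/
def maturityThreshold (H : HestonParams) (m : ℝ) : ℝ :=
  -(8 * H.slope * H.σ * ssviG2 m |H.ρ|) /
    (H.κ * H.θ * Real.sqrt (1 - H.ρ ^ 2) * (4 - H.slope ^ 2 * (1 + |H.ρ|) ^ 2))

end HestonParams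

end

/-!
The Call price curve of a smile with total variance `w` has second derivative in the strike equal,
up to a positive factor, to Durrleman's function
`(1 - k w' / (2 w)) ^ 2 - w' ^ 2 / 16 + (w'' / 2 - w' ^ 2 / (4 w))`
(`hasDerivAt_callSlope`), and every Black–Scholes price satisfies the bounds `(1 - κ)⁺ ≤ C ≤ 1`
(`bsCall_mem_bounds`). So absence of Butterfly arbitrage follows from the nonnegativity of
Durrleman's function (`ButterflyArbitrageFree.of_durrleman_nonneg`).

In the normalized variable `l = (k - m) / σ` the total variance of an SVI is `b σ N(l)`, and the last
summand of Durrleman's function is `b / (2 σ) * g₂(l)`. For an SSVI the quantity `N - (l + m / σ) N'`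
equals `N / (√(1 - ρ ^ 2) √(l ^ 2 + 1)) > 0`, so the square is at least `1 / 4`, while
`w' ^ 2 ≤ b ^ 2 (1 + |ρ|) ^ 2`. Hence a value of `σ` at least
`- 8 b min g₂ / (4 - b ^ 2 (1 + |ρ|) ^ 2)` suffices (`ButterflyArbitrageFree.svi`). In the Heston
parametrization `σ` is proportional to the maturity, which gives the threshold, and `ρ σ < κ` makes
the denominator positive (`HestonParams.slope_mul_lt_two`).

The minimum of `g₂(·, r)` is found from the explicit form `ssviG2_eq`: on the positive half-line the
derivative is a negative multiple of a strictly decreasing function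
(`g2DerivFactor_strictAntiOn`) that changes sign, and `g₂(l, r) ≤ g₂(-l, r)` for `l ≥ 0` takes care
of the negative half-line (`exists_isOnlyPositiveMin_ssviG2`).
-/

/-! ### The standard normal distribution and the Black–Scholes Call price -/

section BlackScholes

open MeasureTheory ProbabilityTheory Set

lemma continuous_gaussianPDFReal (μ : ℝ) (v : NNReal) : Continuous (gaussianPDFReal μ v) := by
  rw [gaussianPDFReal_def]
  fun_prop

lemma stdNormalCDF_eq_integral (x : ℝ) :
    stdNormalCDF x = ∫ t in Iic x, gaussianPDFReal 0 1 t := by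
  rw [stdNormalCDF, cdf_eq_real, measureReal_def,
    gaussianReal_apply_eq_integral 0 one_ne_zero, ENNReal.toReal_ofReal]
  exact integral_nonneg fun t => gaussianPDFReal_nonneg _ _ _

lemma hasDerivAt_stdNormalCDF (x : ℝ) :
    HasDerivAt stdNormalCDF (gaussianPDFReal 0 1 x) x := by
  have hint : ∀ s : Set ℝ, IntegrableOn (gaussianPDFReal 0 1) s := fun s =>
    (integrable_gaussianPDFReal 0 1).integrableOn
  have hΦ : stdNormalCDF =
      fun y => stdNormalCDF 0 + ∫ t in (0 : ℝ)..y, gaussianPDFReal 0 1 t := by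
    funext y
    rw [stdNormalCDF_eq_integral, stdNormalCDF_eq_integral,
      ← intervalIntegral.integral_Iic_sub_Iic (hint _) (hint _)]
    ring
  rw [hΦ]
  exact (intervalIntegral.integral_hasDerivAt_right
    (integrable_gaussianPDFReal 0 1).intervalIntegrable
    ((continuous_gaussianPDFReal 0 1).stronglyMeasurableAtFilter _ _)
    (continuous_gaussianPDFReal 0 1).continuousAt).const_add _

lemma stdNormalCDF_nonneg (x : ℝ) : 0 ≤ stdNormalCDF x := cdf_nonneg _ _

lemma stdNormalCDF_le_one (x : ℝ) : stdNormalCDF x ≤ 1 := cdf_le_one _ _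

lemma stdNormalCDF_neg (x : ℝ) : stdNormalCDF (-x) = 1 - stdNormalCDF x := by
  have hint := (integrable_gaussianPDFReal 0 1)
  have heven : ∀ t, gaussianPDFReal 0 1 (-t) = gaussianPDFReal 0 1 t := by
    intro t; simp [gaussianPDFReal]
  have h1 : ∫ t in Iic (-x), gaussianPDFReal 0 1 t = ∫ t in Ioi x, gaussianPDFReal 0 1 t := by
    have := integral_comp_neg_Ioi x (gaussianPDFReal 0 1)
    simpa only [heven] using this.symm
  have h2 := intervalIntegral.integral_Iic_add_Ioi (b := x) hint.integrableOn hint.integrableOn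
  rw [integral_gaussianPDFReal_eq_one 0 one_ne_zero] at h2
  rw [stdNormalCDF_eq_integral, stdNormalCDF_eq_integral, h1]
  linarith

/-- Completing the square: `d₁ = -k / u + u / 2` is the point at which the density of the normal
law centred at `u`, multiplied by the strike `exp k`, crosses the standard normal density. -/
lemma exp_mul_gaussianPDFReal (k t : ℝ) {u : ℝ} (hu : u ≠ 0) :
    Real.exp k * gaussianPDFReal u 1 t =
      gaussianPDFReal 0 1 t * Real.exp (u * (t - (-k / u + u / 2))) := by
  simp only [gaussianPDFReal]
  rw [mul_left_comm, ← Real.exp_add, mul_assoc (√_)⁻¹, ← Real.exp_add]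
  congr 2
  field_simp
  simp
  ring

lemma stdNormalCDF_sub (d u : ℝ) :
    stdNormalCDF (d - u) = ∫ t in Iic d, gaussianPDFReal u 1 t := by
  have hmap : gaussianReal u 1 = (gaussianReal 0 1).map (· + u) := by
    rw [gaussianReal_map_add_const, zero_add]
  have h : (gaussianReal u 1).real (Iic d) = stdNormalCDF (d - u) := by
    rw [stdNormalCDF, cdf_eq_real, hmap,
      map_measureReal_apply (measurable_add_const u) measurableSet_Iic]
    congr 1
    ext t
    simp [le_sub_iff_add_le]
  rw [← h, measureReal_def, gaussianReal_apply_eq_integral u one_ne_zero, ENNReal.toReal_ofReal]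
  exact integral_nonneg fun t => gaussianPDFReal_nonneg _ _ _

/-- A Black–Scholes Call has nonnegative price. On the half-line `t ≤ d₁` the strike times the
shifted normal density lies below the standard one, and this is the integrated inequality. -/
lemma exp_mul_stdNormalCDF_le (k : ℝ) {u : ℝ} (hu : 0 < u) :
    Real.exp k * stdNormalCDF (-k / u - u / 2) ≤ stdNormalCDF (-k / u + u / 2) := by
  have hd : -k / u - u / 2 = (-k / u + u / 2) - u := by ring
  rw [hd, stdNormalCDF_sub, stdNormalCDF_eq_integral, ← integral_const_mul]
  refine setIntegral_mono_on ((integrable_gaussianPDFReal u 1).const_mul _).integrableOn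
    (integrable_gaussianPDFReal 0 1).integrableOn measurableSet_Iic fun t ht => ?_
  rw [exp_mul_gaussianPDFReal k t hu.ne']
  refine mul_le_of_le_one_right (gaussianPDFReal_nonneg _ _ _) (Real.exp_le_one_iff.2 ?_)
  exact mul_nonpos_of_nonneg_of_nonpos hu.le (sub_nonpos.2 ht)

/-- The Black–Scholes price respects the model-free bounds. The lower bound `1 - κ` is, by
put-call parity, the nonnegativity of a Put, that is, of a Call of strike `κ⁻¹`. -/
lemma bsCall_mem_bounds {κ u : ℝ} (hκ : 0 ≤ κ) (hu : 0 < u) :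
    max (1 - κ) 0 ≤ bsCall κ u ∧ bsCall κ u ≤ 1 := by
  rcases hκ.eq_or_lt with rfl | hκ
  · simp [bsCall]
  obtain ⟨k, rfl⟩ : ∃ k, κ = Real.exp k := ⟨Real.log κ, (Real.exp_log hκ).symm⟩
  rw [bsCall, if_neg hκ.ne', Real.log_exp]
  refine ⟨max_le ?_ (sub_nonneg.2 (exp_mul_stdNormalCDF_le k hu)), ?_⟩
  · have h := exp_mul_stdNormalCDF_le (-k) hu
    have e1 : -(-k) / u - u / 2 = -(-k / u + u / 2) := by ring
    have e2 : -(-k) / u + u / 2 = -(-k / u - u / 2) := by ring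
    rw [e1, e2, stdNormalCDF_neg, stdNormalCDF_neg, Real.exp_neg,
      inv_mul_le_iff₀ (Real.exp_pos k)] at h
    linarith
  · have := stdNormalCDF_le_one (-k / u + u / 2)
    have := mul_nonneg hκ.le (stdNormalCDF_nonneg (-k / u - u / 2))
    linarith

end BlackScholes

/-! ### Durrleman's condition -/

section Durrleman

open ProbabilityTheory Set Filter Topology

/-- A function that is convex on the open half-line stays convex on the closed one if its value
at the endpoint bounds it from above. -/
lemma ConvexOn.Ici_of_Ioi {f : ℝ → ℝ} (hf : ConvexOn ℝ (Ioi 0) f)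
    (h0 : ∀ x, 0 < x → f x ≤ f 0) : ConvexOn ℝ (Ici 0) f := by
  have hcont : ContinuousOn f (Ioi 0) := hf.continuousOn isOpen_Ioi
  have key : ∀ y, 0 < y → ∀ a b : ℝ, 0 ≤ a → 0 < b → a + b = 1 →
      f (b * y) ≤ a * f 0 + b * f y := by
    intro y hy a b ha hb hab
    have hby : 0 < b * y := mul_pos hb hy
    have hlim : Tendsto (fun ε : ℝ => f (a * ε + b * y)) (𝓝[>] 0) (𝓝 (f (b * y))) := by
      have h1 : Tendsto (fun ε : ℝ => a * ε + b * y) (𝓝[>] 0) (𝓝 (b * y)) := by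
        have : Continuous fun ε : ℝ => a * ε + b * y := by fun_prop
        simpa using (this.tendsto 0).mono_left nhdsWithin_le_nhds
      exact ((hcont.continuousAt (Ioi_mem_nhds hby)).tendsto).comp h1
    refine le_of_tendsto hlim ?_
    filter_upwards [self_mem_nhdsWithin] with ε hε
    have h1 := hf.2 hε hy ha hb.le hab
    simp only [smul_eq_mul] at h1
    have h2 := mul_le_mul_of_nonneg_left (h0 ε hε) ha
    linarith
  refine ⟨convex_Ici 0, fun x hx y hy a b ha hb hab => ?_⟩
  simp only [smul_eq_mul]
  rcases ha.eq_or_lt with rfl | ha'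
  · obtain rfl : b = 1 := by linarith
    simp
  rcases hb.eq_or_lt with rfl | hb'
  · obtain rfl : a = 1 := by linarith
    simp
  rcases (mem_Ici.1 hx).eq_or_lt with rfl | hx'
  · rcases (mem_Ici.1 hy).eq_or_lt with rfl | hy'
    · simp [← add_mul, hab]
    · simpa using key y hy' a b ha hb' hab
  · rcases (mem_Ici.1 hy).eq_or_lt with rfl | hy'
    · have := key x hx' b a hb ha' (by linarith)
      simpa [add_comm] using this
    · exact hf.2 hx' hy' ha hb hab

/-- The slope of the Call price curve in the strike, at log-strike `k`, for the total volatility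
curve `u` with derivative `u'`. -/
noncomputable def callSlope (u u' : ℝ → ℝ) (k : ℝ) : ℝ :=
  gaussianPDFReal 0 1 (-k / u k - u k / 2) * u' k - stdNormalCDF (-k / u k - u k / 2)

lemma hasDerivAt_gaussianPDFReal (x : ℝ) :
    HasDerivAt (gaussianPDFReal 0 1) (-x * gaussianPDFReal 0 1 x) x := by
  rw [gaussianPDFReal_def]
  have h : HasDerivAt (fun x : ℝ => -(x - 0) ^ 2 / (2 * ((1 : NNReal) : ℝ))) (-x) x := by
    have := (((hasDerivAt_id x).sub_const 0).pow 2).neg.div_const (2 * ((1 : NNReal) : ℝ))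
    refine HasDerivAt.congr_deriv this (Eq.symm ?_)
    simp
    ring
  refine HasDerivAt.congr_deriv (h.exp.const_mul _) (Eq.symm ?_)
  ring

lemma hasDerivAt_bsCall_exp {u u' : ℝ → ℝ} (hu : ∀ k, 0 < u k)
    (hd : ∀ k, HasDerivAt u (u' k) k) (k : ℝ) :
    HasDerivAt (fun k => bsCall (Real.exp k) (u k)) (Real.exp k * callSlope u u' k) k := by
  have hfun : (fun k => bsCall (Real.exp k) (u k)) = fun k =>
      stdNormalCDF (-k / u k + u k / 2) - Real.exp k * stdNormalCDF (-k / u k - u k / 2) := by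
    funext k
    simp [bsCall, Real.exp_ne_zero]
  have hq := (hasDerivAt_id k).neg.div (hd k) (hu k).ne'
  have hd1 := (hasDerivAt_stdNormalCDF _).comp k (hq.add ((hd k).div_const 2))
  have hd2 := (hasDerivAt_stdNormalCDF _).comp k (hq.sub ((hd k).div_const 2))
  -- The strike times the density at `d₂` is the density at `d₁`.
  have hpdf : gaussianPDFReal 0 1 (-k / u k + u k / 2) =
      Real.exp k * gaussianPDFReal 0 1 (-k / u k - u k / 2) := by
    have h := exp_mul_gaussianPDFReal k (-k / u k + u k / 2) (hu k).ne'
    simp only [sub_self, mul_zero, Real.exp_zero, mul_one] at h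
    rw [← h]
    congr 1
    simp only [gaussianPDFReal]
    congr 3
    ring
  rw [hfun]
  refine HasDerivAt.congr_deriv (hd1.sub ((Real.hasDerivAt_exp k).mul hd2)) (Eq.symm ?_)
  simp only [callSlope, Pi.add_apply, Pi.sub_apply, Pi.div_apply, Pi.neg_apply, id]
  rw [hpdf]
  ring

/-- Twice differentiating the Call price curve in the strike produces Durrleman's function. -/
lemma hasDerivAt_callSlope {u u' u'' : ℝ → ℝ} (hu : ∀ k, 0 < u k)
    (hd : ∀ k, HasDerivAt u (u' k) k) (hd' : ∀ k, HasDerivAt u' (u'' k) k) (k : ℝ) :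
    HasDerivAt (callSlope u u') (gaussianPDFReal 0 1 (-k / u k - u k / 2) *
      (u'' k + ((1 - k * u' k / u k) ^ 2 - (u k * u' k / 2) ^ 2) / u k)) k := by
  have hq := ((hasDerivAt_id k).neg.div (hd k) (hu k).ne').sub ((hd k).div_const 2)
  have h1 := ((hasDerivAt_gaussianPDFReal _).comp k hq).mul (hd' k)
  have h2 := (hasDerivAt_stdNormalCDF _).comp k hq
  have := (hu k).ne'
  refine HasDerivAt.congr_deriv (h1.sub h2) (Eq.symm ?_)
  simp only [Pi.sub_apply, Pi.div_apply, Pi.neg_apply, id, Function.comp]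
  field_simp
  ring

/-- Durrleman's function of a total variance `w` with derivatives `w₁`, `w₂`, at log-forward
moneyness `k`; up to a positive factor it is the second derivative of the Call price curve. -/
noncomputable def durrleman (w w₁ w₂ : ℝ → ℝ) (k : ℝ) : ℝ :=
  (1 - k * w₁ k / (2 * w k)) ^ 2 - w₁ k ^ 2 / 16 + (w₂ k / 2 - w₁ k ^ 2 / (4 * w k))

theorem ButterflyArbitrageFree.of_durrleman_nonneg {w w₁ w₂ : ℝ → ℝ} (hw : ∀ k, 0 < w k)
    (hd : ∀ k, HasDerivAt w (w₁ k) k) (hd' : ∀ k, HasDerivAt w₁ (w₂ k) k)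
    (hg : ∀ k, 0 ≤ durrleman w w₁ w₂ k) : ButterflyArbitrageFree w := by
  have hbounds : ∀ κ, 0 ≤ κ → max (1 - κ) 0 ≤ callCurve w κ ∧ callCurve w κ ≤ 1 :=
    fun κ hκ => bsCall_mem_bounds hκ (Real.sqrt_pos.2 (hw _))
  refine ⟨hw, ?_, hbounds⟩
  set u : ℝ → ℝ := fun k => √(w k) with hu_def
  have hu : ∀ k, 0 < u k := fun k => Real.sqrt_pos.2 (hw k)
  have husq : ∀ k, w k = u k ^ 2 := fun k => (Real.sq_sqrt (hw k).le).symm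
  set u' : ℝ → ℝ := fun k => w₁ k / (2 * u k) with hu'_def
  have hdu : ∀ k, HasDerivAt u (u' k) k := fun k => (hd k).sqrt (hw k).ne'
  have hdu' : ∀ k, HasDerivAt u' (w₂ k / (2 * u k) - w₁ k ^ 2 / (4 * u k ^ 3)) k := by
    intro k
    have := (hu k).ne'
    refine HasDerivAt.congr_deriv ((hd' k).div ((hdu k).const_mul 2) (by positivity))
      (Eq.symm ?_)
    simp only [hu'_def]
    field_simp
    ring
  have hmono : Monotone (callSlope u u') := by
    refine monotone_of_hasDerivAt_nonneg (hasDerivAt_callSlope hu hdu hdu') fun k => ?_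
    have h0 := (hu k).ne'
    have heq : w₂ k / (2 * u k) - w₁ k ^ 2 / (4 * u k ^ 3) +
        ((1 - k * u' k / u k) ^ 2 - (u k * u' k / 2) ^ 2) / u k =
        durrleman w w₁ w₂ k / u k := by
      simp only [hu'_def, durrleman, husq k]
      field_simp
      ring
    simp only [Pi.zero_apply]
    rw [heq]
    exact mul_nonneg (gaussianPDFReal_nonneg _ _ _) (div_nonneg (hg k) (hu k).le)
  have hderiv : ∀ x, 0 < x → HasDerivAt (callCurve w) (callSlope u u' (Real.log x)) x := by
    intro x hx
    have h := (hasDerivAt_bsCall_exp hu hdu (Real.log x)).comp x (Real.hasDerivAt_log hx.ne')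
    rw [Real.exp_log hx, mul_right_comm, mul_inv_cancel₀ hx.ne', one_mul] at h
    refine h.congr_of_eventuallyEq ?_
    filter_upwards [Ioi_mem_nhds hx] with y hy
    simp [callCurve, Real.exp_log (mem_Ioi.1 hy), hu_def]
  refine ConvexOn.Ici_of_Ioi ?_ fun x hx => ?_
  · refine MonotoneOn.convexOn_of_deriv (convex_Ioi 0)
      (fun x hx => (hderiv x hx).continuousAt.continuousWithinAt) ?_ ?_
    · rw [interior_Ioi]
      exact fun x hx => (hderiv x hx).differentiableAt.differentiableWithinAt
    · rw [interior_Ioi]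
      intro x hx y hy hxy
      rw [(hderiv x hx).deriv, (hderiv y hy).deriv]
      exact hmono (Real.log_le_log hx hxy)
  · have h0 : callCurve w 0 = 1 := by simp [callCurve, bsCall]
    rw [h0]
    exact (hbounds x hx.le).2

end Durrleman

/-! ### The function `g₂` of an SSVI -/

section SSVIG2

open Set Filter Topology

lemma sq_sqrt_one_sub_sq {r : ℝ} (hr : |r| < 1) : √(1 - r ^ 2) ^ 2 = 1 - r ^ 2 :=
  Real.sq_sqrt (by nlinarith [sq_lt_one_iff_abs_lt_one r |>.2 hr])

lemma sqrt_one_sub_sq_pos {r : ℝ} (hr : |r| < 1) : 0 < √(1 - r ^ 2) :=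
  Real.sqrt_pos.2 (by nlinarith [sq_lt_one_iff_abs_lt_one r |>.2 hr])

lemma abs_lt_sqrt_sq_add_one (l : ℝ) : |l| < √(l ^ 2 + 1) := by
  rw [← Real.sqrt_sq_eq_abs]
  exact Real.sqrt_lt_sqrt (sq_nonneg l) (by linarith)

lemma sqrt_sq_add_one_pos (l : ℝ) : 0 < √(l ^ 2 + 1) := by positivity

lemma sviN_pos {γ r : ℝ} (hγ : 0 ≤ γ) (hr : |r| < 1) (l : ℝ) : 0 < sviN γ r l := by
  have h1 := abs_lt_sqrt_sq_add_one l
  have h2 : |r * l| ≤ |l| := by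
    rw [abs_mul]
    exact mul_le_of_le_one_left (abs_nonneg l) hr.le
  have := neg_abs_le (r * l)
  unfold sviN
  linarith

/-- With `γ = √(1 - r ^ 2)` the numerator of `N' ^ 2` is divisible by `N`, so that `g₂` is a
polynomial in `l` and `1 / √(l ^ 2 + 1)`. -/
lemma ssviG2_eq {r : ℝ} (hr : |r| < 1) (l : ℝ) :
    ssviG2 l r = 1 / √(l ^ 2 + 1) ^ 3 -
      (√(l ^ 2 + 1) + r * l - √(1 - r ^ 2)) / (2 * √(l ^ 2 + 1) ^ 2) := by
  have hN := (sviN_pos (Real.sqrt_nonneg (1 - r ^ 2)) hr l).ne'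
  have hc := sq_sqrt_one_sub_sq hr
  have hs := Real.sq_sqrt (show 0 ≤ l ^ 2 + 1 by positivity)
  have hs0 := (sqrt_sq_add_one_pos l).ne'
  unfold ssviG2 sviG2 sviN'' sviN'
  unfold sviN at hN ⊢
  generalize √(1 - r ^ 2) = c at *
  generalize √(l ^ 2 + 1) = s at *
  congr 1
  field_simp
  linear_combination hc + (r ^ 2 - 1) * hs

lemma ssviG2_neg (l r : ℝ) : ssviG2 (-l) (-r) = ssviG2 l r := by
  have h : -r + -l / √(l ^ 2 + 1) = -(r + l / √(l ^ 2 + 1)) := by ring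
  simp only [ssviG2, sviG2, sviN, sviN', sviN'', neg_sq, neg_mul_neg, h]

lemma ssviG2_le_neg {r : ℝ} (hr0 : 0 ≤ r) (hr : r < 1) {l : ℝ} (hl : 0 ≤ l) :
    ssviG2 l r ≤ ssviG2 (-l) r := by
  have hr' : |r| < 1 := by rwa [abs_of_nonneg hr0]
  rw [ssviG2_eq hr', ssviG2_eq hr', neg_sq]
  gcongr
  nlinarith

/-- The factor that carries the sign of the derivative of `g₂(·, r)` on the positive half-line. -/
noncomputable def g2DerivFactor (r l : ℝ) : ℝ :=
  6 / √(l ^ 2 + 1) ^ 2 - 1 + 2 * √(1 - r ^ 2) / √(l ^ 2 + 1) -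
    r * (2 * (l / √(l ^ 2 + 1)) - √(l ^ 2 + 1) / l)

lemma hasDerivAt_sqrt_sq_add_one (l : ℝ) :
    HasDerivAt (fun l : ℝ => √(l ^ 2 + 1)) (l / √(l ^ 2 + 1)) l := by
  have h : HasDerivAt (fun l : ℝ => l ^ 2 + 1) (2 * l) l := by
    simpa using (hasDerivAt_pow 2 l).add_const 1
  refine HasDerivAt.congr_deriv (h.sqrt (by positivity)) (Eq.symm ?_)
  rw [mul_div_mul_left _ _ two_ne_zero]

lemma differentiable_ssviG2 {r : ℝ} (hr : |r| < 1) : Differentiable ℝ fun l => ssviG2 l r := by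
  intro l
  have hs := (hasDerivAt_sqrt_sq_add_one l).differentiableAt
  have hs0 := (sqrt_sq_add_one_pos l).ne'
  simp only [ssviG2_eq hr]
  fun_prop (disch := simp [hs0])

lemma hasDerivAt_ssviG2 {r : ℝ} (hr : |r| < 1) {l : ℝ} (hl : l ≠ 0) :
    HasDerivAt (fun l => ssviG2 l r) (-(l / (2 * √(l ^ 2 + 1) ^ 3)) * g2DerivFactor r l) l := by
  have hs := hasDerivAt_sqrt_sq_add_one l
  have hs0 := (sqrt_sq_add_one_pos l).ne'
  have h1 := (hasDerivAt_const l (1 : ℝ)).div (hs.pow 3) (pow_ne_zero 3 hs0)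
  have h2 := ((hs.add ((hasDerivAt_id l).const_mul r)).sub_const √(1 - r ^ 2)).div
    ((hs.pow 2).const_mul 2) (by simp [hs0])
  have hfun : (fun l => ssviG2 l r) = fun l => 1 / √(l ^ 2 + 1) ^ 3 -
      (√(l ^ 2 + 1) + r * l - √(1 - r ^ 2)) / (2 * √(l ^ 2 + 1) ^ 2) :=
    funext (ssviG2_eq hr)
  rw [hfun]
  refine HasDerivAt.congr_deriv (h1.sub h2) (Eq.symm ?_)
  simp only [g2DerivFactor, Pi.pow_apply, Pi.add_apply, id]
  generalize √(1 - r ^ 2) = c at *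
  generalize √(l ^ 2 + 1) = s at *
  field_simp
  simp
  ring

lemma div_sqrt_sq_add_one_strictMonoOn :
    StrictMonoOn (fun l : ℝ => l / √(l ^ 2 + 1)) (Ioi 0) := by
  intro x hx y hy hxy
  have hx' : (0 : ℝ) < x := hx
  have hy' : (0 : ℝ) < y := hy
  rw [div_lt_div_iff₀ (sqrt_sq_add_one_pos x) (sqrt_sq_add_one_pos y)]
  refine lt_of_pow_lt_pow_left₀ 2 (by positivity) ?_
  rw [mul_pow, mul_pow, Real.sq_sqrt (by positivity), Real.sq_sqrt (by positivity)]
  nlinarith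

/-- In terms of `z` with `1 / √(l ^ 2 + 1) = sin z` and `l / √(l ^ 2 + 1) = cos z` the factor is
`6 * sin z ^ 2 - 1 + 2 * c * sin z - r * (2 * cos z - 1 / cos z)`, where every term is monotone. -/
lemma g2DerivFactor_strictAntiOn {r : ℝ} (hr0 : 0 ≤ r) :
    StrictAntiOn (g2DerivFactor r) (Ioi 0) := by
  intro x hx y hy hxy
  have hx' : (0 : ℝ) < x := hx
  have hy' : (0 : ℝ) < y := hy
  have hs : √(x ^ 2 + 1) < √(y ^ 2 + 1) := by
    apply Real.sqrt_lt_sqrt (by positivity)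
    nlinarith
  have hsx := sqrt_sq_add_one_pos x
  have hτ := div_sqrt_sq_add_one_strictMonoOn hx hy hxy
  simp only at hτ
  have hinv : √(y ^ 2 + 1) / y < √(x ^ 2 + 1) / x := by
    rw [← inv_div, ← inv_div x]
    exact inv_strictAnti₀ (by positivity) hτ
  have h1 : 6 / √(y ^ 2 + 1) ^ 2 < 6 / √(x ^ 2 + 1) ^ 2 := by gcongr
  have h2 : 2 * √(1 - r ^ 2) / √(y ^ 2 + 1) ≤ 2 * √(1 - r ^ 2) / √(x ^ 2 + 1) := by gcongr
  have h3 : r * (2 * (x / √(x ^ 2 + 1)) - √(x ^ 2 + 1) / x) ≤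
      r * (2 * (y / √(y ^ 2 + 1)) - √(y ^ 2 + 1) / y) := by
    apply mul_le_mul_of_nonneg_left _ hr0
    linarith
  unfold g2DerivFactor
  linarith

lemma continuousOn_g2DerivFactor (r : ℝ) : ContinuousOn (g2DerivFactor r) (Ioi 0) := by
  intro l hl
  have hs := (hasDerivAt_sqrt_sq_add_one l).continuousAt
  have hs0 := (sqrt_sq_add_one_pos l).ne'
  have hl0 : l ≠ 0 := (mem_Ioi.1 hl).ne'
  refine ContinuousAt.continuousWithinAt ?_
  unfold g2DerivFactor
  fun_prop (disch := simp [hs0])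

lemma exists_g2DerivFactor_eq_zero {r : ℝ} (hr0 : 0 ≤ r) :
    ∃ m, 0 < m ∧ g2DerivFactor r m = 0 := by
  have hc0 := Real.sqrt_nonneg (1 - r ^ 2)
  have hc1 : √(1 - r ^ 2) ≤ 1 := Real.sqrt_le_one.2 (by nlinarith)
  -- The Pythagorean triples `(3, 4, 5)` and `(16, 63, 65)` make the square roots rational.
  have h1 : √((3 / 4 : ℝ) ^ 2 + 1) = 5 / 4 := by
    rw [Real.sqrt_eq_iff_mul_self_eq (by positivity) (by positivity)]; norm_num
  have h2 : √((63 / 16 : ℝ) ^ 2 + 1) = 65 / 16 := by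
    rw [Real.sqrt_eq_iff_mul_self_eq (by positivity) (by positivity)]; norm_num
  have hpos : 0 ≤ g2DerivFactor r (3 / 4) := by
    unfold g2DerivFactor; rw [h1]; nlinarith
  have hneg : g2DerivFactor r (63 / 16) ≤ 0 := by
    unfold g2DerivFactor; rw [h2]; nlinarith
  have hsub : Icc (3 / 4 : ℝ) (63 / 16) ⊆ Ioi 0 := fun x hx => lt_of_lt_of_le (by norm_num) hx.1
  obtain ⟨m, hm, hm0⟩ := intermediate_value_Icc' (by norm_num)
    ((continuousOn_g2DerivFactor r).mono hsub) ⟨hneg, hpos⟩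
  exact ⟨m, hsub hm, hm0⟩

theorem exists_isOnlyPositiveMin_ssviG2 {r : ℝ} (hr0 : 0 ≤ r) (hr : r < 1) :
    ∃ m, IsOnlyPositiveMin (fun l => ssviG2 l r) m := by
  have hr' : |r| < 1 := by rwa [abs_of_nonneg hr0]
  obtain ⟨m, hm, hm0⟩ := exists_g2DerivFactor_eq_zero hr0
  have hanti := g2DerivFactor_strictAntiOn hr0
  have hcont := (differentiable_ssviG2 hr').continuous
  have hleft : AntitoneOn (fun l => ssviG2 l r) (Icc 0 m) := by
    refine antitoneOn_of_hasDerivWithinAt_nonpos (convex_Icc 0 m) hcont.continuousOn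
      (f' := fun l => -(l / (2 * √(l ^ 2 + 1) ^ 3)) * g2DerivFactor r l) ?_ ?_
    · rw [interior_Icc]
      exact fun l hl => (hasDerivAt_ssviG2 hr' hl.1.ne').hasDerivWithinAt
    · rw [interior_Icc]
      intro l hl
      have hl0 := hl.1
      have : 0 < g2DerivFactor r l := hm0 ▸ hanti hl.1 hm hl.2
      exact mul_nonpos_of_nonpos_of_nonneg (neg_nonpos.2 (by positivity)) this.le
  have hright : MonotoneOn (fun l => ssviG2 l r) (Ici m) := by
    refine monotoneOn_of_hasDerivWithinAt_nonneg (convex_Ici m) hcont.continuousOn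
      (f' := fun l => -(l / (2 * √(l ^ 2 + 1) ^ 3)) * g2DerivFactor r l) ?_ ?_
    · rw [interior_Ici]
      exact fun l hl => (hasDerivAt_ssviG2 hr' (hm.trans hl).ne').hasDerivWithinAt
    · rw [interior_Ici]
      intro l hl
      have hl0 : 0 < l := hm.trans hl
      have : g2DerivFactor r l < 0 := hm0 ▸ hanti hm hl0 hl
      exact mul_nonneg_of_nonpos_of_nonpos (neg_nonpos.2 (by positivity)) this.le
  have hmin : ∀ l, 0 ≤ l → ssviG2 m r ≤ ssviG2 l r := by
    intro l hl
    rcases le_total l m with h | h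
    · exact hleft ⟨hl, h⟩ ⟨hm.le, le_rfl⟩ h
    · exact hright (mem_Ici.2 le_rfl) h h
  refine ⟨m, hm, fun l => ?_, fun l hl hloc => ?_⟩
  · rcases le_total 0 l with h | h
    · exact hmin l h
    · have h1 := hmin (-l) (by linarith)
      have h2 := ssviG2_le_neg hr0 hr (l := -l) (by linarith)
      rw [neg_neg] at h2
      exact h1.trans h2
  · have h0 := hloc.hasDerivAt_eq_zero (hasDerivAt_ssviG2 hr' hl.ne')
    have hne : -(l / (2 * √(l ^ 2 + 1) ^ 3)) ≠ 0 := neg_ne_zero.2 (by positivity)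
    exact hanti.injOn hl hm ((mul_eq_zero.1 h0).resolve_left hne |>.trans hm0.symm)

lemma ssviG2_neg_of_isOnlyPositiveMin {r m : ℝ} (hr0 : 0 ≤ r) (hr : r < 1)
    (hm : IsOnlyPositiveMin (fun l => ssviG2 l r) m) : ssviG2 m r < 0 := by
  refine (hm.2.1 (12 / 5)).trans_lt ?_
  -- The Pythagorean triple `(5, 12, 13)` gives a point where `g₂` is visibly negative.
  have hs : √((12 / 5 : ℝ) ^ 2 + 1) = 13 / 5 := by
    rw [Real.sqrt_eq_iff_mul_self_eq (by positivity) (by positivity)]; norm_num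
  have hc1 : √(1 - r ^ 2) ≤ 1 := Real.sqrt_le_one.2 (by nlinarith)
  simp only
  rw [ssviG2_eq (by rwa [abs_of_nonneg hr0]), hs]
  norm_num
  linarith

end SSVIG2

/-! ### SVI smiles of SSVI type and the Heston parameters -/

section SVISmile

lemma abs_sviN'_le (r l : ℝ) : |sviN' r l| ≤ 1 + |r| := by
  have h : |l / √(l ^ 2 + 1)| ≤ 1 := by
    rw [abs_div, abs_of_pos (sqrt_sq_add_one_pos l), div_le_one (sqrt_sq_add_one_pos l)]
    exact (abs_lt_sqrt_sq_add_one l).le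
  calc |sviN' r l| ≤ |r| + |l / √(l ^ 2 + 1)| := abs_add_le _ _
    _ ≤ 1 + |r| := by linarith

lemma hasDerivAt_sviN (γ r l : ℝ) : HasDerivAt (sviN γ r) (sviN' r l) l := by
  have h := (((hasDerivAt_id l).const_mul r).const_add γ).add (hasDerivAt_sqrt_sq_add_one l)
  exact h.congr_deriv (by simp [sviN'])

lemma hasDerivAt_sviN' (r l : ℝ) : HasDerivAt (sviN' r) (sviN'' l) l := by
  have hs0 := (sqrt_sq_add_one_pos l).ne'
  have hsq := Real.sq_sqrt (show 0 ≤ l ^ 2 + 1 by positivity)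
  refine HasDerivAt.congr_deriv
    (((hasDerivAt_id l).div (hasDerivAt_sqrt_sq_add_one l) hs0).const_add r)
    (Eq.symm ?_)
  simp only [sviN'', id]
  field_simp
  linear_combination -hsq

/-- For an SSVI the tangent of the total variance at `k` meets the vertical axis above zero, in
the normalized form `N - (l + μ) N' = N / (√(1 - r ^ 2) √(l ^ 2 + 1))` with
`μ = - r / √(1 - r ^ 2)`; hence `(l + μ) N' ≤ N`. -/
lemma one_half_le_one_sub_sviN' {r : ℝ} (hr : |r| < 1) (l : ℝ) :
    1 / 2 ≤ 1 - (l - r / √(1 - r ^ 2)) * sviN' r l / (2 * sviN √(1 - r ^ 2) r l) := by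
  have hN := sviN_pos (Real.sqrt_nonneg (1 - r ^ 2)) hr l
  have hc0 := sqrt_one_sub_sq_pos hr
  have hs0 := sqrt_sq_add_one_pos l
  have hc := sq_sqrt_one_sub_sq hr
  have hs := Real.sq_sqrt (show 0 ≤ l ^ 2 + 1 by positivity)
  have key : sviN √(1 - r ^ 2) r l - (l - r / √(1 - r ^ 2)) * sviN' r l =
      sviN √(1 - r ^ 2) r l / (√(1 - r ^ 2) * √(l ^ 2 + 1)) := by
    unfold sviN sviN'
    generalize √(1 - r ^ 2) = c at *
    generalize √(l ^ 2 + 1) = s at *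
    field_simp
    linear_combination s * hc + c * hs
  have h : 0 ≤ sviN √(1 - r ^ 2) r l / (√(1 - r ^ 2) * √(l ^ 2 + 1)) := by positivity
  have : (l - r / √(1 - r ^ 2)) * sviN' r l / (2 * sviN √(1 - r ^ 2) r l) ≤ 1 / 2 := by
    rw [div_le_iff₀ (by positivity)]
    linarith
  linarith

/-- An SVI smile of SSVI type is free of Butterfly arbitrage if its parameter `σ` is large compared
with a lower bound `g` of `g₂`: in Durrleman's function the square is at least `1 / 4`, and the
slope of the smile is at most `b (1 + |r|)`. -/
theorem ButterflyArbitrageFree.svi {p : SVIParams} (hb : 0 < p.b) (hσ : 0 < p.σ) (hr : |p.ρ| < 1)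
    (ha : p.a = p.b * p.σ * √(1 - p.ρ ^ 2)) (hm : p.m = -p.σ * (p.ρ / √(1 - p.ρ ^ 2)))
    {g : ℝ} (hg : ∀ l, g ≤ ssviG2 l p.ρ)
    (hbound : -(8 * p.b * g) ≤ p.σ * (4 - p.b ^ 2 * (1 + |p.ρ|) ^ 2)) :
    ButterflyArbitrageFree p.totalVariance := by
  obtain ⟨a, b, r, m, σ⟩ := p
  simp only at *
  set c := √(1 - r ^ 2) with hc_def
  have hw : (SVIParams.mk a b r m σ).totalVariance =
      fun k => b * σ * sviN c r ((k - m) / σ) := by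
    funext k
    have hsqrt : √((k - m) ^ 2 + σ ^ 2) = σ * √(((k - m) / σ) ^ 2 + 1) := by
      rw [← Real.sqrt_sq hσ.le, ← Real.sqrt_mul (sq_nonneg σ), Real.sqrt_sq hσ.le]
      congr 1
      field_simp
    simp only [SVIParams.totalVariance, sviN]
    rw [hsqrt, ha]
    field_simp
    ring
  have hl : ∀ k, HasDerivAt (fun k => (k - m) / σ) (1 / σ) k := fun k =>
    ((hasDerivAt_id k).sub_const m).div_const σ
  have hN := sviN_pos (Real.sqrt_nonneg (1 - r ^ 2)) hr
  rw [hw]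
  refine ButterflyArbitrageFree.of_durrleman_nonneg
    (w₁ := fun k => b * sviN' r ((k - m) / σ)) (w₂ := fun k => b / σ * sviN'' ((k - m) / σ))
    (fun k => mul_pos (mul_pos hb hσ) (hN _)) (fun k => ?_) (fun k => ?_) fun k => ?_
  · refine HasDerivAt.congr_deriv
      (((hasDerivAt_sviN c r _).comp k (hl k)).const_mul (b * σ)) (Eq.symm ?_)
    field_simp
  · refine HasDerivAt.congr_deriv
      (((hasDerivAt_sviN' r _).comp k (hl k)).const_mul b) (Eq.symm ?_)
    field_simp
  obtain ⟨l, rfl⟩ : ∃ l, k = m + σ * l := ⟨(k - m) / σ, by field_simp; ring⟩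
  have hl' : (m + σ * l - m) / σ = l := by field_simp; ring
  have hNl := hN l
  have hsplit : durrleman (fun k => b * σ * sviN c r ((k - m) / σ))
      (fun k => b * sviN' r ((k - m) / σ)) (fun k => b / σ * sviN'' ((k - m) / σ))
      (m + σ * l) = (1 - (l - r / c) * sviN' r l / (2 * sviN c r l)) ^ 2 -
        b ^ 2 * sviN' r l ^ 2 / 16 + b / (2 * σ) * ssviG2 l r := by
    have hk : m + σ * l = σ * (l - r / c) := by rw [hm]; ring
    simp only [durrleman, hl', ssviG2, sviG2, ← hc_def]
    rw [hk]
    generalize l - r / c = x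
    field_simp
    ring
  rw [hsplit]
  have h1 : (1 / 2) ^ 2 ≤ (1 - (l - r / c) * sviN' r l / (2 * sviN c r l)) ^ 2 :=
    pow_le_pow_left₀ (by norm_num) (one_half_le_one_sub_sviN' hr l) 2
  have h2 : sviN' r l ^ 2 ≤ (1 + |r|) ^ 2 := by
    rw [← sq_abs]
    exact pow_le_pow_left₀ (abs_nonneg _) (abs_sviN'_le r l) 2
  have h3 : b ^ 2 * sviN' r l ^ 2 ≤ b ^ 2 * (1 + |r|) ^ 2 := by gcongr
  have h4 : b / (2 * σ) * g ≤ b / (2 * σ) * ssviG2 l r :=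
    mul_le_mul_of_nonneg_left (hg l) (by positivity)
  have h5 : 0 ≤ 1 / 4 - b ^ 2 * (1 + |r|) ^ 2 / 16 + b / (2 * σ) * g := by
    have : 1 / 4 - b ^ 2 * (1 + |r|) ^ 2 / 16 + b / (2 * σ) * g =
        (σ * (4 - b ^ 2 * (1 + |r|) ^ 2) + 8 * b * g) / (16 * σ) := by
      field_simp
      ring
    rw [this]
    exact div_nonneg (by linarith) (by positivity)
  linarith

end SVISmile

namespace HestonParams

variable (H : HestonParams)

lemma one_sub_sq_pos : 0 < 1 - H.ρ ^ 2 :=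
  sub_pos.2 ((sq_lt_one_iff_abs_lt_one _).2 H.abs_ρ_lt_one)

lemma sqrt_sub_pos : 0 < √((2 * H.κ - H.ρ * H.σ) ^ 2 + H.σ ^ 2 * (1 - H.ρ ^ 2)) -
    (2 * H.κ - H.ρ * H.σ) := by
  have h := mul_pos (pow_pos H.σ_pos 2) H.one_sub_sq_pos
  exact sub_pos.2 ((le_abs_self _).trans_lt
    ((Real.sqrt_sq_eq_abs _).symm.trans_lt (Real.sqrt_lt_sqrt (sq_nonneg _) (by linarith))))

lemma slope_pos : 0 < H.slope :=
  mul_pos (div_pos two_pos (mul_pos H.σ_pos H.one_sub_sq_pos)) H.sqrt_sub_pos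

lemma ssviθ_pos {T : ℝ} (hT : 0 < T) : 0 < H.ssviθ T := by
  have := H.κ_pos
  have := H.θ_pos
  have := H.σ_pos
  have := H.one_sub_sq_pos
  exact mul_pos (by positivity) H.sqrt_sub_pos

lemma ssviφ_pos {T : ℝ} (hT : 0 < T) : 0 < H.ssviφ T :=
  div_pos H.σ_pos (mul_pos (mul_pos H.κ_pos H.θ_pos) hT)

lemma longTermSVI_b {T : ℝ} (hT : 0 < T) : (H.longTermSVI T).b = H.slope := by
  have := H.κ_pos
  have := H.θ_pos
  have := H.σ_pos
  have := H.one_sub_sq_pos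
  simp only [longTermSVI, ssviθ, ssviφ, slope]
  field_simp
  ring

lemma totalVariance_longTermSVI {T : ℝ} (hT : 0 < T) (k : ℝ) :
    (H.longTermSVI T).totalVariance k = ssvi (H.ssviθ T) (H.ssviφ T) H.ρ k := by
  have hφ := H.ssviφ_pos hT
  simp only [longTermSVI, SVIParams.totalVariance, ssvi]
  have h : (H.ssviφ T * k + H.ρ) ^ 2 + 1 - H.ρ ^ 2 = H.ssviφ T ^ 2 *
      ((k - -H.ρ / H.ssviφ T) ^ 2 + (√(1 - H.ρ ^ 2) / H.ssviφ T) ^ 2) := by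
    rw [div_pow, Real.sq_sqrt H.one_sub_sq_pos.le]
    field_simp
    ring
  rw [h, Real.sqrt_mul (sq_nonneg _), Real.sqrt_sq hφ.le]
  field_simp
  ring

/-- The steeper wing of the smile has slope less than `2`, which is the meaning of `ρ σ < κ`. -/
lemma slope_mul_lt_two (h : H.ρ * H.σ < H.κ) : H.slope * (1 + |H.ρ|) < 2 := by
  have hκ := H.κ_pos
  have hσ := H.σ_pos
  have hr := H.abs_ρ_lt_one
  have hρ := H.one_sub_sq_pos
  have hsq := sq_abs H.ρ
  have hr0 := abs_nonneg H.ρ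
  have hA : H.σ * |H.ρ| < 2 * H.κ - H.ρ * H.σ := by
    rcases abs_cases H.ρ with ⟨h1, -⟩ | ⟨h1, -⟩ <;> rw [h1] <;> nlinarith
  have hsqrt : √((2 * H.κ - H.ρ * H.σ) ^ 2 + H.σ ^ 2 * (1 - H.ρ ^ 2)) <
      (2 * H.κ - H.ρ * H.σ) + H.σ * (1 - |H.ρ|) := by
    have hpos : 0 < H.σ * (1 - |H.ρ|) := mul_pos hσ (by linarith)
    rw [Real.sqrt_lt' (by nlinarith), ← hsq]
    nlinarith [mul_pos hpos (sub_pos.2 hA)]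
  rw [slope, div_mul_eq_mul_div, div_mul_eq_mul_div, div_lt_iff₀ (mul_pos hσ hρ), ← hsq]
  rw [← hsq] at hsqrt
  nlinarith

theorem butterflyArbitrageFree_longTermSVI (h : H.ρ * H.σ < H.κ) {m T : ℝ}
    (hm : IsOnlyPositiveMin (fun l => ssviG2 l |H.ρ|) m) (hT : H.maturityThreshold m ≤ T) :
    ButterflyArbitrageFree (H.longTermSVI T).totalVariance := by
  have hκ := H.κ_pos
  have hθ := H.θ_pos
  have hσ := H.σ_pos
  have hb := H.slope_pos
  have hc := sqrt_one_sub_sq_pos H.abs_ρ_lt_one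
  have hneg := ssviG2_neg_of_isOnlyPositiveMin (abs_nonneg _) H.abs_ρ_lt_one hm
  have hgap : 0 < 4 - H.slope ^ 2 * (1 + |H.ρ|) ^ 2 := by
    have := H.slope_mul_lt_two h
    have : 0 ≤ H.slope * (1 + |H.ρ|) := by positivity
    nlinarith
  have hden : 0 < H.κ * H.θ * √(1 - H.ρ ^ 2) * (4 - H.slope ^ 2 * (1 + |H.ρ|) ^ 2) := by
    positivity
  have hT0 : 0 < T := by
    refine lt_of_lt_of_le (div_pos ?_ hden) hT
    have : 0 < 8 * H.slope * H.σ := by positivity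
    nlinarith
  have hφ := H.ssviφ_pos hT0
  refine ButterflyArbitrageFree.svi (g := ssviG2 m |H.ρ|) ?_ ?_ H.abs_ρ_lt_one ?_ ?_ ?_ ?_
  · rwa [H.longTermSVI_b hT0]
  · exact div_pos hc hφ
  · simp only [longTermSVI]
    have := Real.sq_sqrt H.one_sub_sq_pos.le
    field_simp
    rw [this]
  · simp only [longTermSVI]
    field_simp
  · intro l
    simp only [longTermSVI]
    rcases abs_cases H.ρ with ⟨h1, -⟩ | ⟨h1, -⟩
    · rw [h1] at hm ⊢
      exact hm.2.1 l
    · rw [h1] at hm ⊢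
      rw [← ssviG2_neg l]
      exact hm.2.1 (-l)
  · rw [H.longTermSVI_b hT0]
    simp only [longTermSVI, ssviφ]
    rw [maturityThreshold, div_le_iff₀ hden] at hT
    rw [div_div_eq_mul_div, div_mul_eq_mul_div, le_div_iff₀ hσ]
    linarith

end HestonParams

theorem mainTheorem6 (H : HestonParams) :
    (∀ T : ℝ, 0 < T →
      0 < H.ssviθ T ∧ 0 < H.ssviφ T ∧ (H.longTermSVI T).b = H.slope ∧
      ∀ k : ℝ, (H.longTermSVI T).totalVariance k = ssvi (H.ssviθ T) (H.ssviφ T) H.ρ k) ∧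
    ∃ m₂ : ℝ, IsOnlyPositiveMin (fun l => ssviG2 l |H.ρ|) m₂ ∧
      (H.ρ * H.σ < H.κ → ∀ T : ℝ, H.maturityThreshold m₂ ≤ T →
        ButterflyArbitrageFree (H.longTermSVI T).totalVariance) := by
  refine ⟨fun T hT => ⟨H.ssviθ_pos hT, H.ssviφ_pos hT, H.longTermSVI_b hT,
    H.totalVariance_longTermSVI hT⟩, ?_⟩
  obtain ⟨m, hm⟩ := exists_isOnlyPositiveMin_ssviG2 (abs_nonneg H.ρ) H.abs_ρ_lt_one
  exact ⟨m, hm, fun h T hT => H.butterflyArbitrageFree_longTermSVI h hm hT⟩
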